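/- Let $d\ge 2$ and $t\ge 0$ be integers, let $X\subset\mathbb{R}^d\setminus\{0\}$ be a finite set and $w:X\to\mathbb{R}_{>0}$. Let $\mathrm{Harm}_j(\mathbb{R}^d)$ be the space of real harmonic homogeneous polynomials of degree $j$ in $d$ variables, and let $Q_j$ be the Gegenbauer polynomial of degree $j$ for the sphere $S^{d-1}$, i.e. the $Q_j$ ($\deg Q_j=j$) are the orthogonal polynomials on $[-1,1]$ with respect to the weight $(1-s^2)^{(d-3)/2}$, normalized by $Q_j(1)=\dim\mathrm{Harm}_j(\mathbb{R}^d)$. Suppose that $(X,w)$ is a strong Euclidean $t$-design, that is, $$\sum_{x,y\in X} w(x)w(y)\,(\|x\|\,\|y\|)^i\,Q_j\!\left(\frac{x}{\|x\|}\cdot\frac{y}{\|y\|}\right)=0\qquad\text{for all } 0\le i\le t,\ 1\le j\le t.$$ Let $p=|\{\|x\| : x\in X\}|$ be the number of spheres centered at the origin that meet $X$. Suppose that $w$ is constant on the intersection of $X$ with each such sphere and that $p\le t+1$. Then $$|X|\ \ge\ \begin{cases}\displaystyle p\left\{\binom{d+e-1}{e}+\binom{d+e-2}{e-1}\right\} &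 \text{if } t=2e,\\[2mm] \displaystyle 2p\binom{d+e-1}{e} & \text{if } t=2e+1,\end{cases}$$ where $e\ge 0$ is an integer and $\binom{n}{-1}=0$. -/

import Mathlib

open scoped BigOperators

noncomputable section

namespace EuclideanDesign

/-- The Laplacian `∑ k, ∂²/∂x_k²` on real polynomials in `d` variables. -/
def laplacian (d : ℕ) : MvPolynomial (Fin d) ℝ →ₗ[ℝ] MvPolynomial (Fin d) ℝ :=
  ∑ k : Fin d, (MvPolynomial.pderiv k).toLinearMap ∘ₗ (MvPolynomial.pderiv k).toLinearMap

/-- The space of harmonic homogeneous polynomials of degree `j` in `d` variables. -/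
def harm (d j : ℕ) : Submodule ℝ (MvPolynomial (Fin d) ℝ) :=
  MvPolynomial.homogeneousSubmodule (Fin d) ℝ j ⊓ LinearMap.ker (laplacian d)

/-- The inner product `∫_{-1}^{1} f(s) g(s) (1 - s²)^((d-3)/2) ds` of two real polynomials.
The weight is integrable for `d ≥ 2`. -/
def weightInner (d : ℕ) (f g : Polynomial ℝ) : ℝ :=
  ∫ s in (-1 : ℝ)..1, f.eval s * g.eval s * (1 - s ^ 2) ^ (((d : ℝ) - 3) / 2)

/-- The monic orthogonal polynomial of degree `j` for `weightInner d`, obtained by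
orthogonalizing `1, X, X², …`. -/
def monicOrthogonal (d : ℕ) (j : ℕ) : Polynomial ℝ :=
  Polynomial.X ^ j - ∑ i : Fin j,
    Polynomial.C (weightInner d (Polynomial.X ^ j) (monicOrthogonal d i) /
      weightInner d (monicOrthogonal d i) (monicOrthogonal d i)) * monicOrthogonal d i
termination_by j
decreasing_by exact i.2

/-- The Gegenbauer polynomial `Q_j` of degree `j` for the sphere `S^(d-1)` (`d ≥ 2`): the
orthogonal polynomial of degree `j` for the weight `(1 - s²)^((d-3)/2)` on `[-1, 1]`,
normalized so that its value at `1` is the dimension of `harm d j`. -/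
def gegenbauer (d j : ℕ) : Polynomial ℝ :=
  Polynomial.C ((Module.finrank ℝ (harm d j) : ℝ) / (monicOrthogonal d j).eval 1) *
    monicOrthogonal d j

/-- The finite weighted set `(X, w)`, with `X ⊆ ℝ^d \ {0}` and `w > 0` on `X`, is a strong
Euclidean `t`-design. -/
structure IsStrongEuclideanDesign {d : ℕ} (t : ℕ) (X : Finset (EuclideanSpace ℝ (Fin d)))
    (w : EuclideanSpace ℝ (Fin d) → ℝ) : Prop where
  zero_notMem : (0 : EuclideanSpace ℝ (Fin d)) ∉ X
  weight_pos : ∀ x ∈ X, 0 < w x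
  sum_eq_zero : ∀ i j : ℕ, i ≤ t → 1 ≤ j → j ≤ t →
    ∑ x ∈ X, ∑ y ∈ X, w x * w y * (‖x‖ * ‖y‖) ^ i *
      (gegenbauer d j).eval (inner ℝ (‖x‖⁻¹ • x) (‖y‖⁻¹ • y)) = 0

/-- The set `{‖x‖ : x ∈ X}` of radii of the spheres about the origin that meet `X`. -/
def radii {d : ℕ} (X : Finset (EuclideanSpace ℝ (Fin d))) : Finset ℝ :=
  X.image (fun x => ‖x‖)

end EuclideanDesign

end

/-!
The proof reduces the theorem to the bounds of Delsarte, Goethals and Seidel for spherical designs,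
applied to each layer `{x ∈ X : ‖x‖ = r}`.

*Splitting into layers.* The kernel `(x, y) ↦ Q_j (⟨x, y⟩)` on the unit sphere is positive
semidefinite, so the vanishing of the quadratic forms in the definition of a strong design says that
`∑ x, w x * ‖x‖ ^ i * Q_j (⟨x / ‖x‖, z⟩) = 0` for every unit vector `z` and every `i ≤ t`
(`sum_monicOrthogonal_eq_zero`). As there are at most `t + 1` norms, interpolation in `‖x‖`
separates the layers (`sum_fiber_eq_zero_of_moments`), and since `w` is constant on a layer, each
layer is a spherical `t`-design (`IsStrongEuclideanDesign.isSphericalDesign_layer`).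

*Positivity.* The orthogonal polynomials satisfy the Gegenbauer differential equation, because the
differential operator is symmetric for the weight and does not raise degrees
(`gegenbauerOp_monicOrthogonal`). Homogenizing them gives the zonal polynomials `zonal d j x`, and
the differential equation becomes the Laplace equation. In the Fischer form
`⟨p, q⟩ = p(∂) q (0)` powers of linear forms reproduce values, while multiples of `∑ i, X i ^ 2` are
orthogonal to harmonic polynomials; hence `⟨zonal x, zonal z⟩ = j! * P_j (⟨x, z⟩)` with `P_j` the
monic orthogonal polynomial, which is a Gram matrix.

*The bound for one layer.* For a spherical `t`-design `v`, expanding powers in the orthogonal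
polynomials shows that `∑ i, ⟨v i, y⟩ ^ k` is a constant multiple of `‖y‖ ^ k` for `k ≤ t`, the
constant being positive for even `k` and zero for odd `k`. By polarization, sums over the design of
forms of odd degree vanish, and sums of forms of even degree are proportional to integrals over the
unit ball. So a form `f` of degree `e` with `2 * e ≤ t` and `∑ i, f (v i) ^ 2 = 0` is zero. For
`t = 2 * e` this embeds the forms of degrees `e` and `e - 1` together into the functions on the
layer. For `t = 2 * e + 1`, let `K` be the projection kernel onto the functions given by forms of
degree `e`; comparing `∑ K(x, y) ^ 2 * (1 + ⟨x, y⟩)` with its diagonal part supplies the factor `2`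
(`two_mul_card_le_of_orthonormal`).
-/

/-! ### Orthogonal polynomials for the weight -/

namespace EuclideanDesign

open Polynomial MeasureTheory Set

/-- The weight is dominated on `(-1, 1)` by `(1 - s²)^(-1/2)`, the derivative of `arcsin`. -/
theorem intervalIntegrable_weight (d : ℕ) (hd : 2 ≤ d) :
    IntervalIntegrable (fun s : ℝ => (1 - s ^ 2) ^ (((d : ℝ) - 3) / 2)) volume (-1) 1 := by
  have hd' : (2 : ℝ) ≤ d := by exact_mod_cast hd
  have harc : IntervalIntegrable (fun s : ℝ => 1 / √(1 - s ^ 2)) volume (-1) 1 := by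
    rw [intervalIntegrable_iff_integrableOn_Ioc_of_le (by norm_num)]
    refine intervalIntegral.integrableOn_deriv_of_nonneg (g := Real.arcsin)
      Real.continuous_arcsin.continuousOn ?_ ?_
    · intro x hx
      exact Real.hasDerivAt_arcsin hx.1.ne' hx.2.ne
    · intro x _
      positivity
  refine harc.mono_fun' ?_ ?_
  · exact Measurable.aestronglyMeasurable (by fun_prop)
  · rw [Filter.EventuallyLE, ae_restrict_iff' measurableSet_uIoc]
    have h1 : ∀ᵐ s : ℝ, s ≠ 1 := by simp [ae_iff]
    filter_upwards [h1] with s hs1 hs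
    rw [uIoc_of_le (by norm_num)] at hs
    have hs2 : s < 1 := lt_of_le_of_ne hs.2 hs1
    have hpos : 0 < 1 - s ^ 2 := by nlinarith [hs.1]
    rw [Real.norm_of_nonneg (by positivity), Real.sqrt_eq_rpow, one_div, ← Real.rpow_neg hpos.le]
    apply Real.rpow_le_rpow_of_exponent_ge hpos (by nlinarith)
    linarith

theorem intervalIntegrable_eval_mul_weight (d : ℕ) (hd : 2 ≤ d) (P : ℝ[X]) :
    IntervalIntegrable (fun s : ℝ => P.eval s * (1 - s ^ 2) ^ (((d : ℝ) - 3) / 2)) volume (-1) 1 :=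
  (intervalIntegrable_weight d hd).continuousOn_mul P.continuous.continuousOn

/-- Integration of polynomials on `[-1, 1]` against the weight `(1 - s²)^((d-3)/2)`. The bound on
`d` makes the integral converge, which linearity needs. -/
noncomputable def weightFunctional (d : ℕ) (hd : 2 ≤ d) : ℝ[X] →ₗ[ℝ] ℝ where
  toFun P := ∫ s in (-1 : ℝ)..1, P.eval s * (1 - s ^ 2) ^ (((d : ℝ) - 3) / 2)
  map_add' P Q := by
    simp only [eval_add, add_mul]
    exact intervalIntegral.integral_add (intervalIntegrable_eval_mul_weight d hd P)
      (intervalIntegrable_eval_mul_weight d hd Q)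
  map_smul' c P := by
    simp only [eval_smul, smul_eq_mul, mul_assoc, intervalIntegral.integral_const_mul,
      RingHom.id_apply]

theorem weightInner_eq (d : ℕ) (hd : 2 ≤ d) (f g : ℝ[X]) :
    weightInner d f g = weightFunctional d hd (f * g) := by
  simp [weightInner, weightFunctional]

theorem weightFunctional_mul_self_pos (d : ℕ) (hd : 2 ≤ d) {P : ℝ[X]} (hP : P ≠ 0) :
    0 < weightFunctional d hd (P * P) := by
  have h := intervalIntegrable_eval_mul_weight d hd (P * P)
  change 0 < ∫ s in (-1 : ℝ)..1, (P * P).eval s * (1 - s ^ 2) ^ (((d : ℝ) - 3) / 2)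
  rw [intervalIntegral.integral_of_le (by norm_num), integral_Ioc_eq_integral_Ioo]
  rw [intervalIntegrable_iff_integrableOn_Ioo_of_le (by norm_num)] at h
  have hw : ∀ s ∈ Ioo (-1 : ℝ) 1, 0 < (1 - s ^ 2) ^ (((d : ℝ) - 3) / 2) := fun s hs =>
    Real.rpow_pos_of_pos (by nlinarith [hs.1, hs.2]) _
  rw [setIntegral_pos_iff_support_of_nonneg_ae ?_ h]
  · have hsub : Ioo (-1 : ℝ) 1 \ (P.roots.toFinset : Set ℝ) ⊆
        (Function.support fun s : ℝ => (P * P).eval s * (1 - s ^ 2) ^ (((d : ℝ) - 3) / 2)) ∩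
          Ioo (-1) 1 := by
      intro s hs
      refine ⟨?_, hs.1⟩
      have : P.eval s ≠ 0 := by
        intro h0
        exact hs.2 (by simp [hP, h0])
      simp only [Function.mem_support, eval_mul]
      exact mul_ne_zero (mul_ne_zero this this) (hw s hs.1).ne'
    refine lt_of_lt_of_le ?_ (measure_mono hsub)
    rw [measure_sdiff_null ((Finset.finite_toSet _).measure_zero _)]
    simp
  · rw [Filter.EventuallyLE, ae_restrict_iff' measurableSet_Ioo]
    filter_upwards with s hs
    have := (hw s hs).le
    simp only [eval_mul, Pi.zero_apply]
    have := mul_self_nonneg (P.eval s)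
    positivity

/-- Integration by parts: the integrand is the derivative of `q(s) (1 - s²)^((d-1)/2)`, which
vanishes at `±1`. -/
theorem weightFunctional_derivative (d : ℕ) (hd : 2 ≤ d) (q : ℝ[X]) :
    weightFunctional d hd ((1 - X ^ 2) * derivative q - C ((d : ℝ) - 1) * X * q) = 0 := by
  have hd' : (2 : ℝ) ≤ d := by exact_mod_cast hd
  have hint := intervalIntegrable_eval_mul_weight d hd
    ((1 - X ^ 2) * derivative q - C ((d : ℝ) - 1) * X * q)
  have hexp : (0 : ℝ) < ((d : ℝ) - 1) / 2 := by linarith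
  have key := intervalIntegral.integral_eq_sub_of_hasDerivAt_of_le (a := -1) (b := 1)
    (f := fun s : ℝ => q.eval s * (1 - s ^ 2) ^ (((d : ℝ) - 1) / 2)) (by norm_num) ?_ ?_ hint
  · refine key.trans ?_
    simp [Real.zero_rpow hexp.ne']
  · refine ContinuousOn.mul q.continuous.continuousOn ?_
    exact ContinuousOn.rpow_const (by fun_prop) fun s _ => Or.inr hexp.le
  · intro s hs
    have hpos : 0 < 1 - s ^ 2 := by nlinarith [hs.1, hs.2]
    have h1 : HasDerivAt (fun s : ℝ => 1 - s ^ 2) (-(2 * s)) s := by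
      simpa using (hasDerivAt_pow 2 s).const_sub 1
    have h2 := (q.hasDerivAt s).mul (h1.rpow_const (p := ((d : ℝ) - 1) / 2) (Or.inl hpos.ne'))
    have e1 : ((d : ℝ) - 1) / 2 = ((d : ℝ) - 3) / 2 + 1 := by ring
    have e2 : ((d : ℝ) - 1) / 2 - 1 = ((d : ℝ) - 3) / 2 := by ring
    refine h2.congr_deriv ?_
    rw [e2, e1, Real.rpow_add_one hpos.ne']
    simp only [eval_sub, eval_mul, eval_one, eval_pow, eval_X, eval_C]
    ring

theorem weightFunctional_X_pow_add_two (d : ℕ) (hd : 2 ≤ d) (k : ℕ) :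
    ((k : ℝ) + d) * weightFunctional d hd (X ^ (k + 2)) =
      ((k : ℝ) + 1) * weightFunctional d hd (X ^ k) := by
  have h := weightFunctional_derivative d hd (X ^ (k + 1))
  have e : ((1 - X ^ 2) * derivative (X ^ (k + 1)) - C ((d : ℝ) - 1) * X * X ^ (k + 1) : ℝ[X]) =
      ((k : ℝ) + 1) • X ^ k - ((k : ℝ) + d) • X ^ (k + 2) := by
    simp only [derivative_X_pow, smul_eq_C_mul, map_add, map_sub, map_natCast, map_one]
    push_cast
    ring
  rw [e, map_sub, map_smul, map_smul, smul_eq_mul, smul_eq_mul] at h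
  linarith

theorem weightFunctional_X_pow_odd (d : ℕ) (hd : 2 ≤ d) (m : ℕ) :
    weightFunctional d hd (X ^ (2 * m + 1)) = 0 := by
  have hd' : (2 : ℝ) ≤ d := by exact_mod_cast hd
  induction m with
  | zero =>
    have h := weightFunctional_derivative d hd 1
    have e : ((1 - X ^ 2) * derivative 1 - C ((d : ℝ) - 1) * X * 1 : ℝ[X]) =
        (-((d : ℝ) - 1)) • X ^ (2 * 0 + 1) := by
      simp [smul_eq_C_mul]
      ring
    rw [e, map_smul, smul_eq_mul] at h
    exact (mul_eq_zero.mp h).resolve_left (by linarith)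
  | succ m ih =>
    have h := weightFunctional_X_pow_add_two d hd (2 * m + 1)
    rw [ih, mul_zero] at h
    refine (mul_eq_zero.mp h).resolve_left ?_
    positivity

theorem weightFunctional_X_pow_even_pos (d : ℕ) (hd : 2 ≤ d) (m : ℕ) :
    0 < weightFunctional d hd (X ^ (2 * m)) := by
  have := weightFunctional_mul_self_pos d hd (P := X ^ m) (pow_ne_zero _ X_ne_zero)
  rwa [← pow_add, ← two_mul] at this

theorem X_pow_eq_sum_monicOrthogonal (d j : ℕ) :
    (X ^ j : ℝ[X]) = monicOrthogonal d j + ∑ i : Fin j,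
      C (weightInner d (X ^ j) (monicOrthogonal d i) /
        weightInner d (monicOrthogonal d i) (monicOrthogonal d i)) * monicOrthogonal d i := by
  conv_rhs => rw [monicOrthogonal]
  ring

theorem monicOrthogonal_monic_natDegree (d j : ℕ) :
    (monicOrthogonal d j).Monic ∧ (monicOrthogonal d j).natDegree = j := by
  induction j using Nat.strong_induction_on with
  | _ j ih =>
    have hdeg : (∑ i : Fin j, C (weightInner d (X ^ j) (monicOrthogonal d i) /
        weightInner d (monicOrthogonal d i) (monicOrthogonal d i)) *
          monicOrthogonal d i).degree < (j : WithBot ℕ) := by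
      rw [degree_lt_iff_coeff_zero]
      intro m hm
      rw [finsetSum_coeff]
      refine Finset.sum_eq_zero fun i _ => ?_
      rw [coeff_C_mul, coeff_eq_zero_of_natDegree_lt, mul_zero]
      rw [(ih i i.2).2]
      exact lt_of_lt_of_le i.2 hm
    constructor
    · rw [monicOrthogonal]
      exact monic_X_pow_sub hdeg
    · rw [monicOrthogonal]
      refine natDegree_eq_of_degree_eq_some ?_
      rw [degree_sub_eq_left_of_degree_lt (by rwa [degree_X_pow]), degree_X_pow]

theorem monicOrthogonal_ne_zero (d j : ℕ) : monicOrthogonal d j ≠ 0 :=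
  (monicOrthogonal_monic_natDegree d j).1.ne_zero

theorem coeff_monicOrthogonal_self (d j : ℕ) : (monicOrthogonal d j).coeff j = 1 := by
  have h := (monicOrthogonal_monic_natDegree d j).1.coeff_natDegree
  rwa [(monicOrthogonal_monic_natDegree d j).2] at h

theorem coeff_monicOrthogonal_of_lt (d : ℕ) {j m : ℕ} (h : j < m) :
    (monicOrthogonal d j).coeff m = 0 :=
  coeff_eq_zero_of_natDegree_lt (by rwa [(monicOrthogonal_monic_natDegree d j).2])

theorem weightFunctional_monicOrthogonal_mul_of_lt (d : ℕ) (hd : 2 ≤ d) (j : ℕ) :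
    ∀ k < j, weightFunctional d hd (monicOrthogonal d j * monicOrthogonal d k) = 0 := by
  induction j using Nat.strong_induction_on with
  | _ j ih =>
    intro k hk
    have hk0 := (weightFunctional_mul_self_pos d hd (monicOrthogonal_ne_zero d k)).ne'
    have hX := congrArg (fun P => weightFunctional d hd (P * monicOrthogonal d k))
      (X_pow_eq_sum_monicOrthogonal d j)
    simp only [add_mul, Finset.sum_mul, map_add, map_sum, ← smul_eq_C_mul, smul_mul_assoc,
      map_smul, smul_eq_mul] at hX
    rw [Finset.sum_eq_single (⟨k, hk⟩ : Fin j)] at hX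
    · simp only [weightInner_eq d hd] at hX
      rw [div_mul_cancel₀ _ hk0] at hX
      linarith
    · intro i _ hi
      have hik : (i : ℕ) ≠ k := fun h => hi (Fin.ext h)
      rcases lt_or_gt_of_ne hik with h | h
      · rw [mul_comm (monicOrthogonal d i), ih k hk i h, mul_zero]
      · rw [ih i i.2 k h, mul_zero]
    · simp

/-- The powers of `X` are triangular combinations of the orthogonal polynomials, so a linear map
is determined by its values on the latter. -/
theorem eq_zero_of_monicOrthogonal {M : Type*} [AddCommGroup M] [Module ℝ M] (d t : ℕ)
    (L : ℝ[X] →ₗ[ℝ] M) (h : ∀ j ≤ t, L (monicOrthogonal d j) = 0) :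
    ∀ k ≤ t, L (X ^ k) = 0 := by
  intro k hk
  rw [X_pow_eq_sum_monicOrthogonal d k, map_add, h k hk, zero_add, map_sum]
  refine Finset.sum_eq_zero fun i _ => ?_
  rw [← smul_eq_C_mul, map_smul, h i (by omega), smul_zero]

theorem weightFunctional_monicOrthogonal_mul_eq_zero (d : ℕ) (hd : 2 ≤ d) (j : ℕ) {q : ℝ[X]}
    (hq : q.degree < j) : weightFunctional d hd (monicOrthogonal d j * q) = 0 := by
  have hX : ∀ k < j, weightFunctional d hd (monicOrthogonal d j * X ^ k) = 0 := by
    intro k hk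
    exact eq_zero_of_monicOrthogonal d k
      ((weightFunctional d hd) ∘ₗ LinearMap.mulLeft ℝ (monicOrthogonal d j))
      (fun i hi => weightFunctional_monicOrthogonal_mul_of_lt d hd j i (by omega)) k le_rfl
  rw [q.as_sum_support_C_mul_X_pow, Finset.mul_sum, map_sum]
  refine Finset.sum_eq_zero fun k hk => ?_
  have hkj : k < j := by
    by_contra hkj
    exact (mem_support_iff.mp hk) ((degree_lt_iff_coeff_zero _ _).mp hq k (by omega))
  rw [mul_left_comm, ← smul_eq_C_mul, map_smul, hX k hkj, smul_zero]

/-- The Gegenbauer differential operator `(1 - s²) q'' - (d - 1) s q'`: the radial part of the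
spherical Laplacian. -/
noncomputable def gegenbauerOp (d : ℕ) (q : ℝ[X]) : ℝ[X] :=
  (1 - X ^ 2) * derivative (derivative q) - C ((d : ℝ) - 1) * X * derivative q

theorem weightFunctional_gegenbauerOp_mul_comm (d : ℕ) (hd : 2 ≤ d) (p q : ℝ[X]) :
    weightFunctional d hd (gegenbauerOp d p * q) =
      weightFunctional d hd (p * gegenbauerOp d q) := by
  have h1 := weightFunctional_derivative d hd (derivative p * q)
  have h2 := weightFunctional_derivative d hd (derivative q * p)
  have e : ((1 - X ^ 2) * derivative (derivative p * q) -
        C ((d : ℝ) - 1) * X * (derivative p * q)) -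
      ((1 - X ^ 2) * derivative (derivative q * p) - C ((d : ℝ) - 1) * X * (derivative q * p)) =
      gegenbauerOp d p * q - p * gegenbauerOp d q := by
    simp only [gegenbauerOp, derivative_mul]
    ring
  rw [← sub_eq_zero, ← map_sub, ← e, map_sub, h1, h2, sub_zero]

theorem coeff_gegenbauerOp (d : ℕ) (q : ℝ[X]) (m : ℕ) :
    (gegenbauerOp d q).coeff m =
      ((m : ℝ) + 2) * (m + 1) * q.coeff (m + 2) - (m : ℝ) * (m + d - 2) * q.coeff m := by
  rw [gegenbauerOp, sub_mul, one_mul, mul_assoc, coeff_sub, coeff_sub, coeff_C_mul]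
  have h1 : (derivative (derivative q)).coeff m = ((m : ℝ) + 2) * (m + 1) * q.coeff (m + 2) := by
    rw [coeff_derivative, coeff_derivative]
    push_cast
    ring
  have h2 : (X * derivative q).coeff m = m * q.coeff m := by
    cases m with
    | zero => simp
    | succ m => rw [coeff_X_mul, coeff_derivative]; push_cast; ring
  have h3 : (X ^ 2 * derivative (derivative q)).coeff m = (m : ℝ) * (m - 1) * q.coeff m := by
    match m with
    | 0 => simp
    | 1 => simp [coeff_X_pow_mul']
    | m + 2 => rw [coeff_X_pow_mul, coeff_derivative, coeff_derivative]; push_cast; ring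
  rw [h1, h2, h3]
  ring

/-- The Gegenbauer differential equation. The operator is symmetric and does not raise degrees,
so the left-hand side is orthogonal to all polynomials of degree less than `j`, while its own
degree is less than `j`. -/
theorem gegenbauerOp_monicOrthogonal (d : ℕ) (hd : 2 ≤ d) (j : ℕ) :
    gegenbauerOp d (monicOrthogonal d j) +
      C ((j : ℝ) * (j + d - 2)) * monicOrthogonal d j = 0 := by
  set R := gegenbauerOp d (monicOrthogonal d j) +
      C ((j : ℝ) * (j + d - 2)) * monicOrthogonal d j with hR
  have hdeg : R.degree < j := by
    rw [degree_lt_iff_coeff_zero]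
    intro m hm
    rw [hR, coeff_add, coeff_gegenbauerOp, coeff_C_mul,
      coeff_monicOrthogonal_of_lt d (show j < m + 2 by omega)]
    rcases hm.eq_or_lt with rfl | h
    · ring
    · rw [coeff_monicOrthogonal_of_lt d h]
      ring
  have hop : (gegenbauerOp d R).degree < j := by
    rw [degree_lt_iff_coeff_zero] at hdeg ⊢
    intro m hm
    rw [coeff_gegenbauerOp, hdeg m hm, hdeg (m + 2) (by omega)]
    ring
  by_contra hne
  have hpos := weightFunctional_mul_self_pos d hd hne
  have : weightFunctional d hd (R * R) = 0 := by
    nth_rewrite 1 [hR]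
    rw [add_mul, map_add, weightFunctional_gegenbauerOp_mul_comm,
      weightFunctional_monicOrthogonal_mul_eq_zero d hd j hop, mul_assoc, ← smul_eq_C_mul, map_smul,
      weightFunctional_monicOrthogonal_mul_eq_zero d hd j hdeg, smul_zero, add_zero]
  exact hpos.ne' this

theorem coeff_monicOrthogonal_rec (d : ℕ) (hd : 2 ≤ d) (j m : ℕ) :
    ((m : ℝ) + 2) * (m + 1) * (monicOrthogonal d j).coeff (m + 2) +
      ((j : ℝ) - m) * (j + m + d - 2) * (monicOrthogonal d j).coeff m = 0 := by
  have h := congrArg (fun P => P.coeff m) (gegenbauerOp_monicOrthogonal d hd j)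
  simp only [coeff_add, coeff_gegenbauerOp, coeff_C_mul, coeff_zero] at h
  linear_combination h

theorem coeff_monicOrthogonal_of_odd (d : ℕ) (hd : 2 ≤ d) (j k : ℕ) :
    ∀ m, m + (2 * k + 1) = j → (monicOrthogonal d j).coeff m = 0 := by
  have hd' : (2 : ℝ) ≤ d := by exact_mod_cast hd
  induction k with
  | zero =>
    intro m hm
    have h := coeff_monicOrthogonal_rec d hd j m
    rw [coeff_monicOrthogonal_of_lt d (by omega), mul_zero, zero_add] at h
    refine (mul_eq_zero.mp h).resolve_left ?_
    subst hm
    push_cast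
    have : (0 : ℝ) ≤ m := m.cast_nonneg
    exact mul_ne_zero (by linarith) (by linarith)
  | succ k ih =>
    intro m hm
    have h := coeff_monicOrthogonal_rec d hd j m
    rw [ih (m + 2) (by omega), mul_zero, zero_add] at h
    refine (mul_eq_zero.mp h).resolve_left ?_
    subst hm
    push_cast
    have : (0 : ℝ) ≤ m := m.cast_nonneg
    have : (0 : ℝ) ≤ k := k.cast_nonneg
    exact mul_ne_zero (by linarith) (by linarith)

/-- The orthogonal polynomial of degree `j` has the parity of `j`. -/
theorem eval_monicOrthogonal (d : ℕ) (hd : 2 ≤ d) (j : ℕ) (s : ℝ) :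
    (monicOrthogonal d j).eval s =
      ∑ k ∈ Finset.range (j / 2 + 1),
        (monicOrthogonal d j).coeff (j - 2 * k) * s ^ (j - 2 * k) := by
  rw [eval_eq_sum_range, (monicOrthogonal_monic_natDegree d j).2]
  symm
  refine Finset.sum_of_injOn (fun k => j - 2 * k) ?_ ?_ ?_ (fun _ _ => rfl)
  · intro a ha b hb hab
    simp only [Finset.coe_range, mem_Iio] at ha hb
    dsimp only at hab
    omega
  · intro a ha
    simp only [Finset.coe_range, mem_Iio] at ha ⊢
    omega
  · intro m hm hm'
    simp only [Finset.mem_range] at hm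
    have hodd : ∃ k, m + (2 * k + 1) = j := by
      by_contra hcon
      push Not at hcon
      refine hm' ⟨(j - m) / 2, ?_, ?_⟩
      · simp only [Finset.coe_range, mem_Iio]; omega
      · have := hcon ((j - m) / 2)
        dsimp only
        omega
    obtain ⟨k, hk⟩ := hodd
    rw [coeff_monicOrthogonal_of_odd d hd j k m hk, zero_mul]

end EuclideanDesign

/-! ### The Fischer form on multivariate polynomials -/

namespace EuclideanDesign

open MvPolynomial
open scoped Matrix

/-- The Fischer (apolar) form `⟨p, q⟩ = p(∂) q (0)`, given on coefficients by
`∑ α, α! p_α q_α`. -/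
noncomputable def fischer (d : ℕ) :
    MvPolynomial (Fin d) ℝ →ₗ[ℝ] MvPolynomial (Fin d) ℝ →ₗ[ℝ] ℝ :=
  (basisMonomials (Fin d) ℝ).constr ℝ fun α => (∏ i, ((α i).factorial : ℝ)) • lcoeff ℝ α

theorem fischer_monomial {d : ℕ} (α : Fin d →₀ ℕ) (a : ℝ) (q : MvPolynomial (Fin d) ℝ) :
    fischer d (monomial α a) q = a * ((∏ i, ((α i).factorial : ℝ)) * coeff α q) := by
  have h : monomial α a = a • basisMonomials (Fin d) ℝ α := by
    rw [coe_basisMonomials, smul_monomial, smul_eq_mul, mul_one]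
  rw [h, map_smul, fischer, Module.Basis.constr_basis]
  simp [lcoeff]

theorem fischer_apply {d : ℕ} (p q : MvPolynomial (Fin d) ℝ) :
    fischer d p q = ∑ α ∈ p.support, coeff α p * ((∏ i, ((α i).factorial : ℝ)) * coeff α q) := by
  conv_lhs => rw [p.as_sum]
  simp only [map_sum, LinearMap.sum_apply, fischer_monomial]

theorem eq_zero_of_fischer_self_eq_zero {d : ℕ} {p : MvPolynomial (Fin d) ℝ}
    (h : fischer d p p = 0) : p = 0 := by
  have hpos : ∀ α : Fin d →₀ ℕ, (0 : ℝ) < ∏ i, ((α i).factorial : ℝ) := fun α =>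
    Finset.prod_pos fun i _ => by exact_mod_cast Nat.factorial_pos _
  rw [fischer_apply, Finset.sum_eq_zero_iff_of_nonneg] at h
  · rw [← support_eq_empty, Finset.eq_empty_iff_forall_notMem]
    intro α hα
    have h1 := h α hα
    rw [mem_support_iff] at hα
    have h2 := (hpos α).ne'
    simp_all
  · intro α _
    have := (hpos α).le
    have := mul_self_nonneg (coeff α p)
    nlinarith

/-- In the Fischer form, multiplication by a variable is adjoint to differentiation. -/
theorem fischer_X_mul {d : ℕ} (i : Fin d) (p q : MvPolynomial (Fin d) ℝ) :
    fischer d (X i * p) q = fischer d p (pderiv i q) := by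
  induction p using MvPolynomial.induction_on' with
  | monomial α a =>
    have hfact : (∏ k, (((α + Finsupp.single i 1 : Fin d →₀ ℕ) k).factorial : ℝ)) =
        (α i + 1) * ∏ k, ((α k).factorial : ℝ) := by
      rw [← Finset.mul_prod_erase _ _ (Finset.mem_univ i),
        ← Finset.mul_prod_erase _ (fun k => ((α k).factorial : ℝ)) (Finset.mem_univ i), ← mul_assoc]
      congr 1
      · simp [Nat.factorial_succ]
      · refine Finset.prod_congr rfl fun k hk => ?_
        simp [(Finset.ne_of_mem_erase hk).symm]
    rw [mul_comm, X, monomial_mul, mul_one, fischer_monomial, fischer_monomial, coeff_pderiv, hfact]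
    ring
  | add p q hp hq =>
    rw [mul_add, map_add, map_add, LinearMap.add_apply, LinearMap.add_apply, hp, hq]

/-- The linear form `∑ i, x i * X i`. -/
noncomputable def linForm {d : ℕ} (x : Fin d → ℝ) : MvPolynomial (Fin d) ℝ :=
  ∑ i, C (x i) * X i

theorem eval_linForm {d : ℕ} (x y : Fin d → ℝ) : eval y (linForm x) = x ⬝ᵥ y := by
  simp [linForm, dotProduct]

theorem isHomogeneous_linForm {d : ℕ} (x : Fin d → ℝ) : (linForm x).IsHomogeneous 1 :=
  IsHomogeneous.sum _ _ _ fun _ _ => isHomogeneous_C_mul_X _ _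

theorem pderiv_linForm {d : ℕ} (x : Fin d → ℝ) (i : Fin d) : pderiv i (linForm x) = C (x i) := by
  classical
  simp [linForm, pderiv_X, Pi.single_apply]

/-- Powers of linear forms reproduce values in the Fischer form. -/
theorem fischer_linForm_pow {d : ℕ} (x : Fin d → ℝ) (j : ℕ) :
    ∀ q : MvPolynomial (Fin d) ℝ, q.IsHomogeneous j →
      fischer d (linForm x ^ j) q = j.factorial * eval x q := by
  induction j with
  | zero =>
    intro q hq
    obtain ⟨c, rfl⟩ : ∃ c, q = C c :=
      ⟨_, totalDegree_eq_zero_iff_eq_C.mp ((totalDegree_zero_iff_isHomogeneous _).mpr hq)⟩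
    have h1 : (linForm x ^ 0) = monomial (0 : Fin d →₀ ℕ) (1 : ℝ) := by simp
    rw [h1, fischer_monomial]
    simp
  | succ j ih =>
    intro q hq
    have hE := congrArg (eval x) hq.sum_X_mul_pderiv
    rw [map_sum, map_nsmul] at hE
    rw [pow_succ']
    nth_rewrite 1 [linForm]
    rw [Finset.sum_mul, map_sum, LinearMap.sum_apply]
    have hterm : ∀ i : Fin d, fischer d (C (x i) * X i * linForm x ^ j) q =
        j.factorial * eval x (X i * pderiv i q) := by
      intro i
      have hq' : (pderiv i q).IsHomogeneous j := hq.pderiv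
      rw [mul_assoc, ← smul_eq_C_mul, map_smul, LinearMap.smul_apply, fischer_X_mul, ih _ hq',
        smul_eq_mul, map_mul, eval_X]
      ring
    rw [Finset.sum_congr rfl fun i _ => hterm i, ← Finset.mul_sum, hE, Nat.factorial_succ]
    push_cast
    simp only [nsmul_eq_mul]
    push_cast
    ring

/-- Polarization: the powers of linear forms span the homogeneous polynomials of given degree. -/
theorem eq_zero_of_linForm_pow {d : ℕ} (k : ℕ) (L : MvPolynomial (Fin d) ℝ →ₗ[ℝ] ℝ)
    (h : ∀ y : Fin d → ℝ, L (linForm y ^ k) = 0) (q : MvPolynomial (Fin d) ℝ)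
    (hq : q.IsHomogeneous k) : L q = 0 := by
  classical
  have hfac : ∀ α : Fin d →₀ ℕ, (∏ i, ((α i).factorial : ℝ)) ≠ 0 := fun α =>
    Finset.prod_ne_zero_iff.mpr fun i _ => by exact_mod_cast Nat.factorial_ne_zero _
  -- `r` represents `L` on forms of degree `k` with respect to the Fischer form
  set A : Finset (Fin d →₀ ℕ) := Finset.univ.finsuppAntidiag k with hA
  have hmem : ∀ α : Fin d →₀ ℕ, α ∈ A ↔ α.degree = k := by
    intro α
    simp [hA, Finset.mem_finsuppAntidiag, Finsupp.degree_eq_sum]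
  set r : MvPolynomial (Fin d) ℝ :=
    ∑ α ∈ A, monomial α ((∏ i, ((α i).factorial : ℝ))⁻¹ * L (monomial α 1)) with hr
  have hrhom : r.IsHomogeneous k := IsHomogeneous.sum _ _ _ fun α hα =>
    isHomogeneous_monomial _ ((hmem α).mp hα)
  have hrep : ∀ g : MvPolynomial (Fin d) ℝ, g.IsHomogeneous k → fischer d g r = L g := by
    intro g hg
    conv_rhs => rw [g.as_sum]
    rw [fischer_apply, map_sum]
    refine Finset.sum_congr rfl fun α hα => ?_
    have hαA : α ∈ A := (hmem α).mpr (by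
      by_contra hne
      exact (mem_support_iff.mp hα) (hg.coeff_eq_zero hne))
    have hc : coeff α r = (∏ i, ((α i).factorial : ℝ))⁻¹ * L (monomial α 1) := by
      rw [hr, coeff_sum, Finset.sum_eq_single α]
      · simp
      · intro β _ hβ
        rw [coeff_monomial, if_neg hβ]
      · exact fun hn => absurd hαA hn
    have hm : monomial α (coeff α g) = coeff α g • monomial α (1 : ℝ) := by
      rw [smul_monomial, smul_eq_mul, mul_one]
    rw [hc, hm, map_smul, smul_eq_mul, mul_inv_cancel_left₀ (hfac α)]
  have hr0 : r = 0 := by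
    refine MvPolynomial.funext fun y => ?_
    have h1 := fischer_linForm_pow y k r hrhom
    have h2 : (linForm y ^ k).IsHomogeneous k := by
      simpa using (isHomogeneous_linForm y).pow k
    rw [hrep _ h2, h y] at h1
    rw [map_zero]
    exact (mul_eq_zero.mp h1.symm).resolve_left (by exact_mod_cast Nat.factorial_ne_zero k)
  rw [← hrep q hq, hr0, map_zero]

theorem finrank_homogeneousSubmodule (d n : ℕ) :
    Module.finrank ℝ (homogeneousSubmodule (Fin d) ℝ n) = (d + n - 1).choose n := by
  have : {α : Fin d →₀ ℕ | α.degree = n} =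
      (Finset.univ.finsuppAntidiag n : Finset (Fin d →₀ ℕ)) := by
    ext α
    simp [Finset.mem_finsuppAntidiag, Finsupp.degree_eq_sum]
  have hb := Module.finrank_eq_card_basis (basisRestrictSupport ℝ
    ((Finset.univ.finsuppAntidiag n : Finset (Fin d →₀ ℕ)) : Set (Fin d →₀ ℕ)))
  rw [homogeneousSubmodule_eq_finsupp_supported, this]
  refine hb.trans ?_
  simp [Finset.card_finsuppAntidiag_nat_eq_choose]

instance finite_homogeneousSubmodule (d n : ℕ) :
    Module.Finite ℝ (homogeneousSubmodule (Fin d) ℝ n) :=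
  Module.Finite.iff_fg.mpr (homogeneousSubmodule_fg (Fin d) ℝ n)

end EuclideanDesign

/-! ### Zonal harmonics and positivity of the Gegenbauer kernel -/

namespace EuclideanDesign

open MvPolynomial
open scoped Matrix

/-- The quadratic form `∑ i, X i ^ 2`. -/
noncomputable def normSqForm (d : ℕ) : MvPolynomial (Fin d) ℝ := ∑ i, X i * X i

theorem eval_normSqForm {d : ℕ} (x : Fin d → ℝ) : eval x (normSqForm d) = x ⬝ᵥ x := by
  simp [normSqForm, dotProduct]

theorem isHomogeneous_normSqForm (d : ℕ) : (normSqForm d).IsHomogeneous 2 :=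
  IsHomogeneous.sum _ _ _ fun i _ => (isHomogeneous_X ℝ i).mul (isHomogeneous_X ℝ i)

theorem pderiv_normSqForm {d : ℕ} (i : Fin d) : pderiv i (normSqForm d) = 2 * X i := by
  classical
  simp only [normSqForm, map_sum, pderiv_mul, pderiv_X, Pi.single_apply]
  simp [Finset.sum_add_distrib, two_mul]

theorem laplacian_apply {d : ℕ} (p : MvPolynomial (Fin d) ℝ) :
    laplacian d p = ∑ i, pderiv i (pderiv i p) := by
  simp [laplacian]

theorem fischer_normSqForm_mul {d : ℕ} (p q : MvPolynomial (Fin d) ℝ) :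
    fischer d (normSqForm d * p) q = fischer d p (laplacian d q) := by
  rw [normSqForm, Finset.sum_mul, map_sum, LinearMap.sum_apply, laplacian_apply, map_sum]
  refine Finset.sum_congr rfl fun i _ => ?_
  rw [mul_assoc, fischer_X_mul, fischer_X_mul]

theorem laplacian_mul {d : ℕ} (p q : MvPolynomial (Fin d) ℝ) :
    laplacian d (p * q) = laplacian d p * q + 2 * ∑ i, pderiv i p * pderiv i q +
      p * laplacian d q := by
  simp only [laplacian_apply, Finset.sum_mul, Finset.mul_sum, ← Finset.sum_add_distrib]
  refine Finset.sum_congr rfl fun i _ => ?_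
  simp only [pderiv_mul, map_add]
  ring

theorem laplacian_linForm_pow {d : ℕ} {x : Fin d → ℝ} (hx : x ⬝ᵥ x = 1) (m : ℕ) :
    laplacian d (linForm x ^ m) = C ((m : ℝ) * (m - 1)) * linForm x ^ (m - 2) := by
  have h2 : ∀ i, pderiv i (pderiv i (linForm x ^ m)) =
      C (x i * x i) * (C ((m : ℝ) * (m - 1)) * linForm x ^ (m - 2)) := by
    intro i
    match m with
    | 0 => simp
    | 1 => simp [pderiv_linForm]
    | m + 2 =>
      rw [pderiv_pow, pderiv_linForm]
      simp only [Nat.add_sub_cancel, show m + 2 - 1 = m + 1 by omega, pderiv_mul, pderiv_pow,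
        pderiv_linForm, pderiv_C]
      rw [show ((m + 2 : ℕ) : MvPolynomial (Fin d) ℝ) = C ((m + 2 : ℕ) : ℝ) from
        (map_natCast C _).symm, pderiv_C]
      push_cast
      simp only [map_mul, map_sub, map_add, map_natCast, map_ofNat, map_one]
      ring
  rw [laplacian_apply, Finset.sum_congr rfl fun i _ => h2 i, ← Finset.sum_mul, ← map_sum]
  rw [dotProduct] at hx
  rw [hx, map_one, one_mul]

theorem laplacian_normSqForm_pow (d k : ℕ) :
    laplacian d (normSqForm d ^ k) =
      C (2 * (k : ℝ) * (2 * k - 2 + d)) * normSqForm d ^ (k - 1) := by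
  have h2 : ∀ i : Fin d, pderiv i (pderiv i (normSqForm d ^ k)) =
      C (4 * (k : ℝ) * (k - 1)) * normSqForm d ^ (k - 2) * (X i * X i) +
        C (2 * (k : ℝ)) * normSqForm d ^ (k - 1) := by
    intro i
    match k with
    | 0 => simp
    | 1 =>
      rw [pow_one, pderiv_normSqForm, ← map_ofNat C 2, pderiv_C_mul]
      simp
    | k + 2 =>
      rw [pderiv_pow, pderiv_normSqForm]
      simp only [Nat.add_sub_cancel, show k + 2 - 1 = k + 1 by omega]
      rw [show ((k + 2 : ℕ) : MvPolynomial (Fin d) ℝ) * normSqForm d ^ (k + 1) * (2 * X i) =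
        C (2 * (k + 2 : ℝ)) * (normSqForm d ^ (k + 1) * X i) by
          simp only [map_mul, map_add, map_natCast, map_ofNat]
          push_cast
          ring,
        pderiv_C_mul,
        pderiv_mul, pderiv_pow, pderiv_normSqForm, pderiv_X_self]
      push_cast
      simp only [map_mul, map_sub, map_add, map_natCast, map_ofNat, map_one]
      ring
  rw [laplacian_apply, Finset.sum_congr rfl fun i _ => h2 i, Finset.sum_add_distrib,
    ← Finset.mul_sum, ← normSqForm, Finset.sum_const, Finset.card_univ, Fintype.card_fin]
  match k with
  | 0 => simp
  | 1 => simp; ring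
  | k + 2 =>
    simp only [Nat.add_sub_cancel, show k + 2 - 1 = k + 1 by omega]
    push_cast
    simp only [map_mul, map_sub, map_add, map_natCast, map_ofNat, map_one, nsmul_eq_mul]
    ring

theorem sum_pderiv_linForm_pow_mul {d : ℕ} (x : Fin d → ℝ) (m k : ℕ) :
    ∑ i, pderiv i (linForm x ^ m) * pderiv i (normSqForm d ^ k) =
      C (2 * (m : ℝ) * k) * (linForm x ^ m * normSqForm d ^ (k - 1)) := by
  have h : ∀ i : Fin d, pderiv i (linForm x ^ m) * pderiv i (normSqForm d ^ k) =
      C (2 * (m : ℝ) * k) * linForm x ^ (m - 1) * normSqForm d ^ (k - 1) * (C (x i) * X i) := by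
    intro i
    rw [pderiv_pow, pderiv_pow, pderiv_linForm, pderiv_normSqForm]
    simp only [map_mul, map_natCast, map_ofNat]
    ring
  rw [Finset.sum_congr rfl fun i _ => h i, ← Finset.mul_sum, ← linForm]
  cases m with
  | zero => simp
  | succ m => rw [Nat.add_sub_cancel]; ring

theorem laplacian_linForm_pow_mul {d : ℕ} {x : Fin d → ℝ} (hx : x ⬝ᵥ x = 1) (m k : ℕ) :
    laplacian d (linForm x ^ m * normSqForm d ^ k) =
      C ((m : ℝ) * (m - 1)) * (linForm x ^ (m - 2) * normSqForm d ^ k) +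
      C (2 * (k : ℝ) * (2 * m + 2 * k - 2 + d)) * (linForm x ^ m * normSqForm d ^ (k - 1)) := by
  rw [laplacian_mul, laplacian_linForm_pow hx, laplacian_normSqForm_pow,
    sum_pderiv_linForm_pow_mul]
  simp only [map_mul, map_sub, map_add, map_natCast, map_ofNat, map_one]
  ring

/-- The zonal harmonic of degree `j` with pole the unit vector `x`: the homogenization of
`s ↦ (monicOrthogonal d j).eval s` at `s = ⟨x, y⟩`, as a polynomial in `y`. -/
noncomputable def zonal (d j : ℕ) (x : Fin d → ℝ) : MvPolynomial (Fin d) ℝ :=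
  ∑ k ∈ Finset.range (j / 2 + 1), C ((monicOrthogonal d j).coeff (j - 2 * k)) *
    (linForm x ^ (j - 2 * k) * normSqForm d ^ k)

theorem isHomogeneous_zonal (d j : ℕ) (x : Fin d → ℝ) : (zonal d j x).IsHomogeneous j := by
  refine IsHomogeneous.sum _ _ _ fun k hk => ?_
  have hk' : 1 * (j - 2 * k) + 2 * k = j := by
    rw [Finset.mem_range] at hk
    omega
  have h := (((isHomogeneous_linForm x).pow (j - 2 * k)).mul
    ((isHomogeneous_normSqForm d).pow k)).C_mul ((monicOrthogonal d j).coeff (j - 2 * k))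
  rwa [hk'] at h

/-- The Gegenbauer differential equation says that zonal harmonics are harmonic. -/
theorem laplacian_zonal {d : ℕ} (hd : 2 ≤ d) (j : ℕ) {x : Fin d → ℝ} (hx : x ⬝ᵥ x = 1) :
    laplacian d (zonal d j x) = 0 := by
  rw [zonal, map_sum]
  simp only [← smul_eq_C_mul, map_smul]
  simp only [laplacian_linForm_pow_mul hx, smul_add, ← smul_eq_C_mul, smul_smul]
  -- the first term with index `k` cancels the second one with index `k + 1`
  rw [Finset.sum_add_distrib, Finset.sum_range_succ, Finset.sum_range_succ']
  have hlast : ((j - 2 * (j / 2) : ℕ) : ℝ) * (((j - 2 * (j / 2) : ℕ) : ℝ) - 1) = 0 := by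
    rcases (show j - 2 * (j / 2) = 0 ∨ j - 2 * (j / 2) = 1 by omega) with h | h <;> rw [h] <;> simp
  rw [hlast]
  simp only [mul_zero, zero_smul, add_zero, Nat.cast_zero, zero_mul]
  rw [← Finset.sum_add_distrib]
  refine Finset.sum_eq_zero fun k hk => ?_
  rw [Finset.mem_range] at hk
  obtain ⟨m, rfl⟩ : ∃ m, j = m + 2 + 2 * k := ⟨j - 2 - 2 * k, by omega⟩
  have hrec := coeff_monicOrthogonal_rec d hd (m + 2 + 2 * k) m
  rw [show m + 2 + 2 * k - 2 * k = m + 2 by omega,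
    show m + 2 + 2 * k - 2 * (k + 1) = m by omega, show m + 2 - 2 = m by omega,
    show k + 1 - 1 = k by omega, ← add_smul]
  convert zero_smul ℝ _
  push_cast at hrec ⊢
  linear_combination hrec

theorem zonal_mem_harm {d : ℕ} (hd : 2 ≤ d) (j : ℕ) {x : Fin d → ℝ} (hx : x ⬝ᵥ x = 1) :
    zonal d j x ∈ harm d j :=
  ⟨isHomogeneous_zonal d j x, laplacian_zonal hd j hx⟩

theorem eval_zonal {d : ℕ} (hd : 2 ≤ d) (j : ℕ) (x : Fin d → ℝ) {z : Fin d → ℝ}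
    (hz : z ⬝ᵥ z = 1) :
    eval z (zonal d j x) = (monicOrthogonal d j).eval (x ⬝ᵥ z) := by
  rw [eval_monicOrthogonal d hd, zonal, map_sum]
  refine Finset.sum_congr rfl fun k _ => ?_
  simp [eval_linForm, eval_normSqForm, hz]

/-- A zonal harmonic differs from a power of a linear form by a multiple of `∑ i, X i ^ 2`, which
the Fischer form makes orthogonal to harmonic polynomials. -/
theorem fischer_zonal {d : ℕ} (j : ℕ) (x : Fin d → ℝ) {q : MvPolynomial (Fin d) ℝ}
    (hq : q ∈ harm d j) : fischer d (zonal d j x) q = j.factorial * eval x q := by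
  have hΔ : laplacian d q = 0 := hq.2
  rw [zonal, map_sum, LinearMap.sum_apply, Finset.sum_range_succ', Finset.sum_eq_zero]
  · rw [← smul_eq_C_mul, map_smul, LinearMap.smul_apply, mul_zero, Nat.sub_zero, pow_zero, mul_one,
      coeff_monicOrthogonal_self, one_smul, zero_add, fischer_linForm_pow x j q hq.1]
  · intro k _
    rw [← smul_eq_C_mul, map_smul, LinearMap.smul_apply, pow_succ', mul_left_comm,
      fischer_normSqForm_mul, hΔ, map_zero, smul_zero]

/-- The kernel `G_j(⟨x, z⟩)` on the unit sphere is positive semidefinite: it is a Gram matrix of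
zonal harmonics. Hence a vector on which the quadratic form vanishes lies in its kernel. -/
theorem sum_monicOrthogonal_eq_zero {d : ℕ} (hd : 2 ≤ d) (j : ℕ) {ι : Type*} (s : Finset ι)
    (a : ι → ℝ) (v : ι → Fin d → ℝ) (hv : ∀ i ∈ s, v i ⬝ᵥ v i = 1)
    (h : ∑ i ∈ s, ∑ l ∈ s, a i * a l * (monicOrthogonal d j).eval (v i ⬝ᵥ v l) = 0)
    {z : Fin d → ℝ} (hz : z ⬝ᵥ z = 1) :
    ∑ i ∈ s, a i * (monicOrthogonal d j).eval (v i ⬝ᵥ z) = 0 := by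
  set u : MvPolynomial (Fin d) ℝ := ∑ i ∈ s, a i • zonal d j (v i) with hu
  have hmem : u ∈ harm d j :=
    Submodule.sum_mem _ fun i hi => Submodule.smul_mem _ _ (zonal_mem_harm hd j (hv i hi))
  have heval : ∀ y : Fin d → ℝ, y ⬝ᵥ y = 1 →
      eval y u = ∑ i ∈ s, a i * (monicOrthogonal d j).eval (v i ⬝ᵥ y) := by
    intro y hy
    rw [hu, map_sum]
    refine Finset.sum_congr rfl fun i _ => ?_
    rw [smul_eval, eval_zonal hd j _ hy]
  have h0 : fischer d u u = 0 := by
    have hsum : fischer d u u = ∑ i ∈ s, fischer d (a i • zonal d j (v i)) u := by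
      rw [← LinearMap.sum_apply, ← map_sum]
    rw [hsum]
    have : ∀ i ∈ s, fischer d (a i • zonal d j (v i)) u = j.factorial *
        ∑ l ∈ s, a i * a l * (monicOrthogonal d j).eval (v i ⬝ᵥ v l) := by
      intro i hi
      rw [map_smul, LinearMap.smul_apply, fischer_zonal j _ hmem, heval _ (hv i hi), smul_eq_mul,
        Finset.mul_sum, Finset.mul_sum, Finset.mul_sum]
      refine Finset.sum_congr rfl fun l _ => ?_
      rw [dotProduct_comm]
      ring
    rw [Finset.sum_congr rfl this, ← Finset.mul_sum, h, mul_zero]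
  rw [← heval z hz, eq_zero_of_fischer_self_eq_zero h0, map_zero]

theorem eval_one_monicOrthogonal_ne_zero {d : ℕ} (hd : 2 ≤ d) (j : ℕ) :
    (monicOrthogonal d j).eval 1 ≠ 0 := by
  intro h1
  set i₀ : Fin d := ⟨0, by omega⟩
  set i₁ : Fin d := ⟨1, by omega⟩
  have hne : i₀ ≠ i₁ := by simp [i₀, i₁]
  have hsub : Set.Icc (-1 : ℝ) 1 ⊆ {s | (monicOrthogonal d j).IsRoot s} := by
    intro s hs
    have hs2 : 0 ≤ 1 - s ^ 2 := by nlinarith [hs.1, hs.2]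
    have hz : (Pi.single i₀ s + Pi.single i₁ √(1 - s ^ 2) : Fin d → ℝ) ⬝ᵥ
        (Pi.single i₀ s + Pi.single i₁ √(1 - s ^ 2)) = 1 := by
      simp [hne, hne.symm, Real.mul_self_sqrt hs2]
      ring
    have := sum_monicOrthogonal_eq_zero hd j (Finset.univ : Finset Unit) (fun _ => 1)
      (fun _ => Pi.single i₀ 1) (by simp) (by simpa using h1) hz
    simpa [hne, hne.symm] using this
  exact monicOrthogonal_ne_zero d j (Polynomial.eq_zero_of_infinite_isRoot _
    ((Set.Icc_infinite (by norm_num)).mono hsub))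

theorem finrank_harm_pos {d : ℕ} (hd : 2 ≤ d) (j : ℕ) : 0 < Module.finrank ℝ (harm d j) := by
  have hx : (Pi.single ⟨0, by omega⟩ 1 : Fin d → ℝ) ⬝ᵥ Pi.single ⟨0, by omega⟩ 1 = 1 := by simp
  have : Module.Finite ℝ (harm d j) :=
    Submodule.finiteDimensional_of_le (inf_le_left : harm d j ≤ homogeneousSubmodule (Fin d) ℝ j)
  have hne : zonal d j (Pi.single ⟨0, by omega⟩ 1) ≠ 0 := by
    intro h0
    have h := eval_zonal hd j (Pi.single ⟨0, by omega⟩ 1) hx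
    rw [h0, hx, map_zero] at h
    exact eval_one_monicOrthogonal_ne_zero hd j h.symm
  have : Nontrivial (harm d j) :=
    ⟨⟨⟨_, zonal_mem_harm hd j hx⟩, 0, fun h => hne (congrArg Subtype.val h)⟩⟩
  exact Module.finrank_pos

/-- The normalizing constant of `gegenbauer` does not vanish. -/
theorem exists_gegenbauer_eq {d : ℕ} (hd : 2 ≤ d) (j : ℕ) :
    ∃ c : ℝ, c ≠ 0 ∧ ∀ s, (gegenbauer d j).eval s = c * (monicOrthogonal d j).eval s := by
  refine ⟨(Module.finrank ℝ (harm d j) : ℝ) / (monicOrthogonal d j).eval 1,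
    div_ne_zero ?_ (eval_one_monicOrthogonal_ne_zero hd j), fun s => ?_⟩
  · exact Nat.cast_ne_zero.mpr (finrank_harm_pos hd j).ne'
  · rw [gegenbauer, Polynomial.eval_mul, Polynomial.eval_C]

end EuclideanDesign

/-! ### Bounds for spherical designs -/

namespace EuclideanDesign

open MvPolynomial MeasureTheory Metric
open scoped Matrix

theorem inner_eq_dotProduct {d : ℕ} (x y : EuclideanSpace ℝ (Fin d)) :
    inner ℝ x y = x.ofLp ⬝ᵥ y.ofLp := by
  rw [EuclideanSpace.inner_eq_star_dotProduct, dotProduct_comm]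
  simp

theorem continuous_eval_ofLp {d : ℕ} (p : MvPolynomial (Fin d) ℝ) :
    Continuous fun x : EuclideanSpace ℝ (Fin d) => eval x.ofLp p :=
  (MvPolynomial.continuous_eval p).comp (PiLp.continuous_ofLp 2 _)

theorem integrableOn_eval_ball {d : ℕ} (p : MvPolynomial (Fin d) ℝ) :
    IntegrableOn (fun x : EuclideanSpace ℝ (Fin d) => eval x.ofLp p) (ball 0 1) :=
  ((continuous_eval_ofLp p).continuousOn.integrableOn_compact
    (isCompact_closedBall 0 1)).mono_set ball_subset_closedBall

/-- Integration of polynomials over the unit ball. -/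
noncomputable def ballIntegral (d : ℕ) : MvPolynomial (Fin d) ℝ →ₗ[ℝ] ℝ where
  toFun p := ∫ x : EuclideanSpace ℝ (Fin d) in ball 0 1, eval x.ofLp p
  map_add' p q := by
    simp only [map_add]
    exact integral_add (integrableOn_eval_ball p) (integrableOn_eval_ball q)
  map_smul' c p := by
    simp only [smul_eval, integral_const_mul, RingHom.id_apply, smul_eq_mul]

theorem linForm_smul {d : ℕ} (c : ℝ) (x : Fin d → ℝ) : linForm (c • x) = C c * linForm x := by
  simp only [linForm, Finset.mul_sum, Pi.smul_apply, smul_eq_mul, map_mul, mul_assoc]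

theorem eval_smul_of_isHomogeneous {d e : ℕ} {f : MvPolynomial (Fin d) ℝ} (hf : f.IsHomogeneous e)
    (c : ℝ) (x : Fin d → ℝ) : eval (c • x) f = c ^ e * eval x f := by
  have h1 := fischer_linForm_pow (c • x) e f hf
  rw [linForm_smul, mul_pow, ← map_pow, ← smul_eq_C_mul, map_smul, LinearMap.smul_apply,
    fischer_linForm_pow x e f hf, smul_eq_mul] at h1
  have h2 : (e.factorial : ℝ) ≠ 0 := by exact_mod_cast e.factorial_ne_zero
  apply mul_left_cancel₀ h2
  linarith

theorem eq_zero_of_ballIntegral_mul_self {d e : ℕ} {f : MvPolynomial (Fin d) ℝ}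
    (hf : f.IsHomogeneous e) (h : ballIntegral d (f * f) = 0) : f = 0 := by
  change ∫ x : EuclideanSpace ℝ (Fin d) in ball 0 1, eval x.ofLp (f * f) = 0 at h
  rw [integral_eq_zero_iff_of_nonneg _ (integrableOn_eval_ball _)] at h
  · have h0 := Measure.eqOn_open_of_ae_eq h isOpen_ball (continuous_eval_ofLp _).continuousOn
      continuousOn_const
    refine MvPolynomial.funext fun x => ?_
    rw [map_zero]
    set y : EuclideanSpace ℝ (Fin d) := WithLp.toLp 2 x
    have hpos : 0 < ‖y‖ + 1 := by positivity
    have hy : (‖y‖ + 1)⁻¹ • y ∈ ball (0 : EuclideanSpace ℝ (Fin d)) 1 := by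
      rw [mem_ball_zero_iff, norm_smul, norm_inv, Real.norm_of_nonneg hpos.le, inv_mul_lt_one₀ hpos]
      linarith
    have h1 := h0 hy
    simp only [map_mul, Pi.zero_apply, mul_self_eq_zero] at h1
    have h2 : eval ((‖y‖ + 1)⁻¹ • x) f = 0 := h1
    rw [eval_smul_of_isHomogeneous hf] at h2
    exact (mul_eq_zero.mp h2).resolve_left (by positivity)
  · intro x
    simp only [map_mul, Pi.zero_apply]
    exact mul_self_nonneg _

/-- The moments of linear forms over the ball are invariant under rotations. -/
theorem ballIntegral_linForm_pow_eq {d : ℕ} (k : ℕ) {x y : Fin d → ℝ} (h : x ⬝ᵥ x = y ⬝ᵥ y) :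
    ballIntegral d (linForm x ^ k) = ballIntegral d (linForm y ^ k) := by
  set x' : EuclideanSpace ℝ (Fin d) := WithLp.toLp 2 x
  set y' : EuclideanSpace ℝ (Fin d) := WithLp.toLp 2 y
  have hn : ‖x'‖ = ‖y'‖ := by
    have hx : ‖x'‖ ^ 2 = x ⬝ᵥ x := by rw [← real_inner_self_eq_norm_sq, inner_eq_dotProduct]
    have hy : ‖y'‖ ^ 2 = y ⬝ᵥ y := by rw [← real_inner_self_eq_norm_sq, inner_eq_dotProduct]
    exact (sq_eq_sq₀ (norm_nonneg _) (norm_nonneg _)).mp (by rw [hx, hy, h])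
  set ρ : EuclideanSpace ℝ (Fin d) ≃ₗᵢ[ℝ] EuclideanSpace ℝ (Fin d) :=
    (ℝ ∙ (y' - x'))ᗮ.reflection
  have hρ : ρ y' = x' := Submodule.reflection_sub hn.symm
  have hev : ∀ (u : Fin d → ℝ) (z : EuclideanSpace ℝ (Fin d)), eval z.ofLp (linForm u ^ k) =
      (inner ℝ (WithLp.toLp 2 u : EuclideanSpace ℝ (Fin d)) z) ^ k := by
    intro u z
    rw [map_pow, eval_linForm, inner_eq_dotProduct]
  change ∫ z : EuclideanSpace ℝ (Fin d) in ball 0 1, eval z.ofLp (linForm x ^ k) =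
    ∫ z : EuclideanSpace ℝ (Fin d) in ball 0 1, eval z.ofLp (linForm y ^ k)
  simp only [hev]
  have hpre : ρ ⁻¹' (ball 0 1) = ball 0 1 := by
    ext z
    simp
  rw [← (LinearIsometryEquiv.measurePreserving ρ).setIntegral_preimage_emb
    ρ.toHomeomorph.measurableEmbedding _ (ball 0 1), hpre]
  change ∫ z in ball 0 1, (inner ℝ x' (ρ z)) ^ k = _
  rw [← hρ]
  simp only [LinearIsometryEquiv.inner_map_map]
  rfl

theorem exists_eq_smul_unit {d : ℕ} (hd : 2 ≤ d) (y : Fin d → ℝ) :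
    ∃ (r : ℝ) (z : Fin d → ℝ), z ⬝ᵥ z = 1 ∧ y = r • z := by
  by_cases hy : y ⬝ᵥ y = 0
  · rw [dotProduct_self_eq_zero] at hy
    exact ⟨0, Pi.single ⟨0, by omega⟩ 1, by simp, by simp [hy]⟩
  · have hpos : 0 < y ⬝ᵥ y := lt_of_le_of_ne
      (Finset.sum_nonneg fun i _ => mul_self_nonneg (y i)) (Ne.symm hy)
    have hs : √(y ⬝ᵥ y) ≠ 0 := (Real.sqrt_pos.mpr hpos).ne'
    refine ⟨√(y ⬝ᵥ y), (√(y ⬝ᵥ y))⁻¹ • y, ?_, ?_⟩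
    · rw [smul_dotProduct, dotProduct_smul, smul_eq_mul, smul_eq_mul, ← mul_assoc, ← mul_inv,
        Real.mul_self_sqrt hpos.le, inv_mul_cancel₀ hy]
    · rw [smul_smul, mul_inv_cancel₀ hs, one_smul]

/-- A finite family of vectors is a spherical `t`-design if the vectors have norm one and their
sums against all Gegenbauer polynomials of degrees `1, …, t` vanish. -/
structure IsSphericalDesign {ι : Type*} [Fintype ι] {d : ℕ} (t : ℕ) (v : ι → Fin d → ℝ) :
    Prop where
  unit : ∀ i, v i ⬝ᵥ v i = 1
  sum_eq_zero : ∀ j, 1 ≤ j → j ≤ t → ∀ z : Fin d → ℝ, z ⬝ᵥ z = 1 →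
    ∑ i, (monicOrthogonal d j).eval (v i ⬝ᵥ z) = 0

namespace IsSphericalDesign

variable {ι : Type*} [Fintype ι] {d t : ℕ} {v : ι → Fin d → ℝ}

theorem sum_pow (hv : IsSphericalDesign t v) (hd : 2 ≤ d) {k : ℕ} (hk : k ≤ t)
    {z : Fin d → ℝ} (hz : z ⬝ᵥ z = 1) :
    weightFunctional d hd 1 * ∑ i, (v i ⬝ᵥ z) ^ k =
      Fintype.card ι * weightFunctional d hd (Polynomial.X ^ k) := by
  have h := eq_zero_of_monicOrthogonal d t
    (weightFunctional d hd 1 • (∑ i, Polynomial.leval (v i ⬝ᵥ z)) -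
      (Fintype.card ι : ℝ) • weightFunctional d hd) ?_ k hk
  · simp only [LinearMap.sub_apply, LinearMap.smul_apply, LinearMap.sum_apply,
      Polynomial.leval_apply, Polynomial.eval_pow, Polynomial.eval_X, smul_eq_mul] at h
    linarith
  · intro j hj
    simp only [LinearMap.sub_apply, LinearMap.smul_apply, LinearMap.sum_apply,
      Polynomial.leval_apply, smul_eq_mul]
    rcases Nat.eq_zero_or_pos j with rfl | hj0
    · have h1 : monicOrthogonal d 0 = 1 := by
        obtain ⟨hm, hn⟩ := monicOrthogonal_monic_natDegree d 0
        exact hm.natDegree_eq_zero.mp hn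
      simp [h1]
      ring
    · have h1 := weightFunctional_monicOrthogonal_mul_eq_zero d hd j (q := 1) (by
        rw [Polynomial.degree_one]; exact_mod_cast hj0)
      rw [mul_one] at h1
      rw [h1, hv.sum_eq_zero j hj0 hj z hz]
      ring

theorem sum_eval_of_odd (hv : IsSphericalDesign t v) (hd : 2 ≤ d) {m : ℕ} (hm : 2 * m + 1 ≤ t)
    {f : MvPolynomial (Fin d) ℝ} (hf : f.IsHomogeneous (2 * m + 1)) : ∑ i, eval (v i) f = 0 := by
  have h1 := weightFunctional_mul_self_pos d hd (P := 1) one_ne_zero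
  rw [mul_one] at h1
  have h := eq_zero_of_linForm_pow (2 * m + 1) (∑ i, (aeval (v i)).toLinearMap) ?_ f hf
  · simpa [LinearMap.sum_apply, aeval_eq_eval] using h
  · intro y
    obtain ⟨r, z, hz, rfl⟩ := exists_eq_smul_unit hd y
    have h2 := hv.sum_pow hd hm hz
    rw [weightFunctional_X_pow_odd, mul_zero] at h2
    have h3 := (mul_eq_zero.mp h2).resolve_left h1.ne'
    simp only [LinearMap.sum_apply, AlgHom.toLinearMap_apply, aeval_eq_eval, linForm_smul, mul_pow,
      map_mul, map_pow, eval_C, eval_linForm]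
    rw [← Finset.mul_sum]
    simp only [dotProduct_comm z, h3, mul_zero]

/-- On forms of even degree, summation over the design is proportional to integration over the
ball. -/
theorem sum_eval_of_even (hv : IsSphericalDesign t v) (hd : 2 ≤ d) {m : ℕ} (hm : 2 * m ≤ t) :
    ∃ c : ℝ, ∀ f : MvPolynomial (Fin d) ℝ, f.IsHomogeneous (2 * m) →
      c * ∑ i, eval (v i) f =
        Fintype.card ι * weightFunctional d hd (Polynomial.X ^ (2 * m)) * ballIntegral d f := by
  set e₀ : Fin d → ℝ := Pi.single ⟨0, by omega⟩ 1
  have he : e₀ ⬝ᵥ e₀ = 1 := by simp [e₀]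
  refine ⟨ballIntegral d (linForm e₀ ^ (2 * m)) * weightFunctional d hd 1, fun f hf => ?_⟩
  have h := eq_zero_of_linForm_pow (2 * m)
    ((ballIntegral d (linForm e₀ ^ (2 * m)) * weightFunctional d hd 1) •
      (∑ i, (aeval (v i)).toLinearMap) -
      (Fintype.card ι * weightFunctional d hd (Polynomial.X ^ (2 * m))) • ballIntegral d) ?_ f hf
  · simp only [LinearMap.sub_apply, LinearMap.smul_apply, LinearMap.sum_apply,
      AlgHom.toLinearMap_apply, aeval_eq_eval, smul_eq_mul] at h
    linarith
  · intro y
    obtain ⟨r, z, hz, rfl⟩ := exists_eq_smul_unit hd y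
    have h2 := hv.sum_pow hd hm hz
    have h3 := ballIntegral_linForm_pow_eq (2 * m) (hz.trans he.symm)
    simp only [LinearMap.sub_apply, LinearMap.smul_apply, LinearMap.sum_apply,
      AlgHom.toLinearMap_apply, aeval_eq_eval, linForm_smul, mul_pow,
      map_mul, map_pow, eval_C, eval_linForm, ← Finset.mul_sum, dotProduct_comm z]
    rw [← map_pow, ← smul_eq_C_mul, map_smul, h3]
    simp only [smul_eq_mul]
    linear_combination (ballIntegral d (linForm e₀ ^ (2 * m)) * r ^ (2 * m)) * h2

theorem eq_zero_of_sum_mul_self [Nonempty ι] (hv : IsSphericalDesign t v) (hd : 2 ≤ d) {m : ℕ}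
    (hm : 2 * m ≤ t) {f : MvPolynomial (Fin d) ℝ} (hf : f.IsHomogeneous m)
    (h : ∑ i, eval (v i) (f * f) = 0) : f = 0 := by
  obtain ⟨c, hc⟩ := hv.sum_eval_of_even hd hm
  have hff : (f * f).IsHomogeneous (2 * m) := by
    rw [two_mul]
    exact hf.mul hf
  have h1 := hc _ hff
  rw [h, mul_zero] at h1
  refine eq_zero_of_ballIntegral_mul_self hf ((mul_eq_zero.mp h1.symm).resolve_left ?_)
  refine mul_ne_zero ?_ (weightFunctional_X_pow_even_pos d hd m).ne'
  exact_mod_cast Fintype.card_ne_zero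

/-- Forms of degree `e + 1` and `e` are jointly determined by their values on a design of strength
`2 (e + 1)`: the cross terms in the sum of squares have odd degree. -/
theorem choose_add_choose_le_card [Nonempty ι] (hv : IsSphericalDesign t v) (hd : 2 ≤ d) {e : ℕ}
    (he : 2 * (e + 1) ≤ t) :
    (d + (e + 1) - 1).choose (e + 1) + (d + e - 1).choose e ≤ Fintype.card ι := by
  let T : (homogeneousSubmodule (Fin d) ℝ (e + 1) × homogeneousSubmodule (Fin d) ℝ e) →ₗ[ℝ]
      (ι → ℝ) := LinearMap.pi fun i =>
    (aeval (v i)).toLinearMap ∘ₗ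
      (Submodule.subtype _).coprod (Submodule.subtype _)
  have hT : ∀ p i, T p i = eval (v i) (p.1 : MvPolynomial (Fin d) ℝ) +
      eval (v i) (p.2 : MvPolynomial (Fin d) ℝ) := by
    intro p i
    simp [T, aeval_eq_eval]
  have hinj : Function.Injective T := by
    rw [injective_iff_map_eq_zero]
    rintro ⟨⟨f, hf⟩, ⟨g, hg⟩⟩ h0
    have hsum : ∑ i, eval (v i) (f * f) + ∑ i, eval (v i) (g * g) = 0 := by
      have hfg : (f * g).IsHomogeneous (2 * e + 1) := by
        convert IsHomogeneous.mul hf hg using 1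
        ring
      have hodd := hv.sum_eval_of_odd hd (by omega) hfg
      have : ∑ i, (eval (v i) f + eval (v i) g) ^ 2 = 0 := by
        refine Finset.sum_eq_zero fun i _ => ?_
        have := congrFun h0 i
        rw [hT] at this
        simp only [Pi.zero_apply] at this
        rw [this]
        ring
      have hexp : ∑ i, (eval (v i) f + eval (v i) g) ^ 2 = ∑ i, eval (v i) (f * f) +
          2 * ∑ i, eval (v i) (f * g) + ∑ i, eval (v i) (g * g) := by
        rw [Finset.mul_sum, ← Finset.sum_add_distrib, ← Finset.sum_add_distrib]
        refine Finset.sum_congr rfl fun i _ => ?_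
        simp only [map_mul]
        ring
      rw [this, hodd] at hexp
      linarith
    have hnn : ∀ p : MvPolynomial (Fin d) ℝ, 0 ≤ ∑ i, eval (v i) (p * p) := fun p =>
      Finset.sum_nonneg fun i _ => by rw [map_mul]; exact mul_self_nonneg _
    have hf0 := hv.eq_zero_of_sum_mul_self hd he hf (by linarith [hnn f, hnn g])
    have hg0 := hv.eq_zero_of_sum_mul_self hd (by omega) hg (by linarith [hnn f, hnn g])
    subst hf0 hg0
    rfl
  have := LinearMap.finrank_le_finrank_of_injective hinj
  rwa [Module.finrank_prod, finrank_homogeneousSubmodule, finrank_homogeneousSubmodule,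
    Module.finrank_fintype_fun_eq_card] at this

end IsSphericalDesign

/-- Let `B` be an orthonormal family of functions on `ι` with kernel `K i l = ∑ a, B a i * B a l`.
The hypothesis `hB` makes the sum of `K i l ^ 2 * ⟨v i, v l⟩` vanish, so comparing the diagonal of
`∑ K i l ^ 2 * (1 + ⟨v i, v l⟩)` with the whole sum gives the bound. -/
theorem two_mul_card_le_of_orthonormal {ι A : Type*} [Fintype ι] [Fintype A] {d : ℕ}
    {v : ι → Fin d → ℝ} (hv : ∀ i, v i ⬝ᵥ v i = 1) [DecidableEq A] (B : A → ι → ℝ)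
    (horth : ∀ a b, ∑ i, B a i * B b i = if a = b then 1 else 0)
    (hB : ∀ a b k, ∑ i, B a i * B b i * v i k = 0) :
    2 * Fintype.card A ≤ Fintype.card ι := by
  set K : ι → ι → ℝ := fun i l => ∑ a, B a i * B a l with hK
  have hKsq : ∀ i l, K i l ^ 2 = ∑ a, ∑ b, (B a i * B b i) * (B a l * B b l) := by
    intro i l
    rw [hK, sq, Finset.sum_mul_sum]
    exact Finset.sum_congr rfl fun a _ => Finset.sum_congr rfl fun b _ => by ring
  have htrace : ∑ i, K i i = Fintype.card A := by
    rw [hK, Finset.sum_comm]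
    simp [horth]
  have h1 : ∑ i, ∑ l, K i l ^ 2 = Fintype.card A := by
    rw [← htrace]
    refine Finset.sum_congr rfl fun i _ => ?_
    simp only [hKsq]
    rw [Finset.sum_comm]
    refine Finset.sum_congr rfl fun a _ => ?_
    rw [Finset.sum_comm]
    simp [← Finset.mul_sum, horth]
  have h2 : ∑ i, ∑ l, K i l ^ 2 * (v i ⬝ᵥ v l) = 0 := by
    have : ∀ i, ∑ l, K i l ^ 2 * (v i ⬝ᵥ v l) = 0 := by
      intro i
      have hl : ∀ l, K i l ^ 2 * (v i ⬝ᵥ v l) =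
          ∑ a, ∑ b, ∑ k, (B a i * B b i * v i k) * (B a l * B b l * v l k) := by
        intro l
        rw [hKsq, Finset.sum_mul]
        refine Finset.sum_congr rfl fun a _ => ?_
        rw [Finset.sum_mul]
        refine Finset.sum_congr rfl fun b _ => ?_
        rw [dotProduct, Finset.mul_sum]
        exact Finset.sum_congr rfl fun k _ => by ring
      rw [Finset.sum_congr rfl fun l _ => hl l, Finset.sum_comm]
      refine Finset.sum_eq_zero fun a _ => ?_
      rw [Finset.sum_comm]
      refine Finset.sum_eq_zero fun b _ => ?_
      rw [Finset.sum_comm]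
      refine Finset.sum_eq_zero fun k _ => ?_
      rw [← Finset.mul_sum, hB, mul_zero]
    simp [this]
  have hnn : ∀ i l, 0 ≤ 1 + v i ⬝ᵥ v l := by
    intro i l
    have h : 0 ≤ (v i + v l) ⬝ᵥ (v i + v l) := Finset.sum_nonneg fun k _ => mul_self_nonneg _
    rw [add_dotProduct, dotProduct_add, dotProduct_add, hv, hv, dotProduct_comm (v l)] at h
    linarith
  have h3 : 2 * ∑ i, K i i ^ 2 ≤ Fintype.card A := by
    calc 2 * ∑ i, K i i ^ 2 = ∑ i, K i i ^ 2 * (1 + v i ⬝ᵥ v i) := by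
          rw [Finset.mul_sum]
          exact Finset.sum_congr rfl fun i _ => by rw [hv]; ring
      _ ≤ ∑ i, ∑ l, K i l ^ 2 * (1 + v i ⬝ᵥ v l) := Finset.sum_le_sum fun i _ =>
          Finset.single_le_sum (f := fun l => K i l ^ 2 * (1 + v i ⬝ᵥ v l))
            (fun l _ => mul_nonneg (sq_nonneg _) (hnn i l)) (Finset.mem_univ i)
      _ = Fintype.card A := by
          simp only [mul_add, mul_one, Finset.sum_add_distrib, h1, h2, add_zero]
  have h4 := sq_sum_le_card_mul_sum_sq (s := Finset.univ) (f := fun i => K i i)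
  rw [htrace, Finset.card_univ] at h4
  rcases Nat.eq_zero_or_pos (Fintype.card A) with h0 | h0
  · omega
  · have h0' : (0 : ℝ) < Fintype.card A := by exact_mod_cast h0
    have hι : (0 : ℝ) ≤ Fintype.card ι := Nat.cast_nonneg _
    have : (2 * Fintype.card A : ℝ) ≤ Fintype.card ι := by
      refine le_of_mul_le_mul_right ?_ h0'
      nlinarith
    exact_mod_cast this

theorem IsSphericalDesign.two_mul_choose_le_card {ι : Type*} [Fintype ι] [Nonempty ι] {d t : ℕ}
    {v : ι → Fin d → ℝ} (hv : IsSphericalDesign t v) (hd : 2 ≤ d) {e : ℕ} (he : 2 * e + 1 ≤ t) :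
    2 * (d + e - 1).choose e ≤ Fintype.card ι := by
  let T : homogeneousSubmodule (Fin d) ℝ e →ₗ[ℝ] EuclideanSpace ℝ ι :=
    (WithLp.linearEquiv 2 ℝ (ι → ℝ)).symm.toLinearMap ∘ₗ LinearMap.pi fun i =>
      (aeval (v i)).toLinearMap ∘ₗ Submodule.subtype _
  have hT : ∀ p i, T p i = eval (v i) (p : MvPolynomial (Fin d) ℝ) := by
    intro p i
    simp [T, aeval_eq_eval]
  have hinj : Function.Injective T := by
    rw [injective_iff_map_eq_zero]
    rintro ⟨f, hf⟩ h0
    have : f = 0 := by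
      refine hv.eq_zero_of_sum_mul_self hd (by omega) hf (Finset.sum_eq_zero fun i _ => ?_)
      have h1 := hT ⟨f, hf⟩ i
      rw [h0] at h1
      rw [map_mul, ← h1]
      simp
    subst this
    rfl
  have hrank := LinearMap.finrank_range_of_inj hinj
  rw [finrank_homogeneousSubmodule] at hrank
  let b := stdOrthonormalBasis ℝ (LinearMap.range T)
  have hex : ∀ a, ∃ f : homogeneousSubmodule (Fin d) ℝ e, T f = (b a : EuclideanSpace ℝ ι) :=
    fun a => (b a).2
  choose f hf using hex
  have := two_mul_card_le_of_orthonormal hv.unit (fun a i => eval (v i) (f a : MvPolynomial _ ℝ))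
    ?_ ?_
  · rwa [Fintype.card_fin, hrank] at this
  · intro a c
    have h := orthonormal_iff_ite.mp b.orthonormal a c
    rw [Submodule.coe_inner, ← hf, ← hf, PiLp.inner_apply] at h
    simpa [hT, mul_comm] using h
  · intro a c k
    have hhom : ((f a : MvPolynomial (Fin d) ℝ) * (f c : MvPolynomial (Fin d) ℝ) *
        X k).IsHomogeneous (2 * e + 1) := by
      convert (IsHomogeneous.mul (f a).2 (f c).2).mul (isHomogeneous_X ℝ k) using 1
      ring
    simpa using hv.sum_eval_of_odd hd he hhom

end EuclideanDesign

/-! ### Separation of the layers -/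

namespace EuclideanDesign

open scoped Matrix

/-- If `ρ` takes at most `t + 1` values, the indicator function of one of them is a polynomial of
degree at most `t` in `ρ`, so vanishing moments force the sum over each fiber of `ρ` to vanish. -/
theorem sum_fiber_eq_zero_of_moments {α : Type*} (X : Finset α) (ρ g : α → ℝ) {t : ℕ}
    (hcard : (X.image ρ).card ≤ t + 1) (h : ∀ i ≤ t, ∑ x ∈ X, ρ x ^ i * g x = 0)
    {r : ℝ} (hr : r ∈ X.image ρ) : ∑ x ∈ X with ρ x = r, g x = 0 := by
  classical
  set P : Polynomial ℝ := ∏ s ∈ (X.image ρ).erase r, (Polynomial.X - Polynomial.C s) with hP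
  have hdeg : P.natDegree < t + 1 := by
    rw [hP, Polynomial.natDegree_finsetProd_X_sub_C_eq_card, Finset.card_erase_of_mem hr]
    have := Finset.card_pos.mpr ⟨r, hr⟩
    omega
  have hsum : ∑ x ∈ X, P.eval (ρ x) * g x = 0 := by
    simp only [Polynomial.eval_eq_sum_range' hdeg, Finset.sum_mul]
    rw [Finset.sum_comm]
    refine Finset.sum_eq_zero fun i hi => ?_
    rw [Finset.mem_range] at hi
    simp only [mul_assoc]
    rw [← Finset.mul_sum, h i (by omega), mul_zero]
  have hsplit : ∑ x ∈ X, P.eval (ρ x) * g x = P.eval r * ∑ x ∈ X with ρ x = r, g x := by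
    rw [Finset.mul_sum, Finset.sum_filter]
    refine Finset.sum_congr rfl fun x hx => ?_
    split_ifs with hxr
    · rw [hxr]
    · have : P.eval (ρ x) = 0 := by
        rw [hP, Polynomial.eval_prod]
        refine Finset.prod_eq_zero
          (Finset.mem_erase.mpr ⟨hxr, Finset.mem_image_of_mem ρ hx⟩) ?_
        simp
      rw [this, zero_mul]
  rw [hsplit] at hsum
  refine (mul_eq_zero.mp hsum).resolve_left ?_
  rw [hP, Polynomial.eval_prod]
  refine Finset.prod_ne_zero_iff.mpr fun s hs => ?_
  simpa [sub_eq_zero] using (Finset.ne_of_mem_erase hs).symm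

/-- Each layer of the design, rescaled to the unit sphere, is a spherical design. -/
theorem IsStrongEuclideanDesign.isSphericalDesign_layer {d t : ℕ} (hd : 2 ≤ d)
    {X : Finset (EuclideanSpace ℝ (Fin d))} {w : EuclideanSpace ℝ (Fin d) → ℝ}
    (hX : IsStrongEuclideanDesign t X w) (hw : ∀ x ∈ X, ∀ y ∈ X, ‖x‖ = ‖y‖ → w x = w y)
    (hcard : (radii X).card ≤ t + 1) {r : ℝ} (hr : r ∈ radii X) :
    IsSphericalDesign t fun x : {x // x ∈ X.filter fun x => ‖x‖ = r} =>
      (‖x.1‖⁻¹ • x.1).ofLp := by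
  have hunit : ∀ x ∈ X, (‖x‖⁻¹ • x).ofLp ⬝ᵥ (‖x‖⁻¹ • x).ofLp = 1 := by
    intro x hx
    have hx0 : x ≠ 0 := fun h => hX.zero_notMem (h ▸ hx)
    rw [← inner_eq_dotProduct, real_inner_self_eq_norm_sq, norm_smul, norm_inv, norm_norm,
      inv_mul_cancel₀ (norm_ne_zero_iff.mpr hx0), one_pow]
  refine ⟨fun x => hunit x.1 (Finset.mem_filter.mp x.2).1, fun j hj hjt z hz => ?_⟩
  obtain ⟨c, hc, hG⟩ := exists_gegenbauer_eq hd j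
  have hmom : ∀ i ≤ t, ∑ x ∈ X, ‖x‖ ^ i *
      (w x * (monicOrthogonal d j).eval ((‖x‖⁻¹ • x).ofLp ⬝ᵥ z)) = 0 := by
    intro i hi
    have h := hX.sum_eq_zero i j hi hj hjt
    have h' : ∑ x ∈ X, ∑ y ∈ X, (w x * ‖x‖ ^ i) * (w y * ‖y‖ ^ i) *
        (monicOrthogonal d j).eval ((‖x‖⁻¹ • x).ofLp ⬝ᵥ (‖y‖⁻¹ • y).ofLp) = 0 := by
      apply mul_left_cancel₀ hc
      rw [mul_zero, ← h, Finset.mul_sum]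
      refine Finset.sum_congr rfl fun x _ => ?_
      rw [Finset.mul_sum]
      refine Finset.sum_congr rfl fun y _ => ?_
      rw [hG, inner_eq_dotProduct, mul_pow]
      ring
    rw [← sum_monicOrthogonal_eq_zero hd j X _ _ hunit h' hz]
    exact Finset.sum_congr rfl fun x _ => by ring
  have h := sum_fiber_eq_zero_of_moments X (fun x => ‖x‖) _ hcard hmom hr
  obtain ⟨x₀, hx₀, hx₀r⟩ := Finset.mem_image.mp hr
  have h2 : w x₀ * ∑ x ∈ X with ‖x‖ = r,
      (monicOrthogonal d j).eval ((‖x‖⁻¹ • x).ofLp ⬝ᵥ z) = 0 := by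
    rw [← h, Finset.mul_sum]
    refine Finset.sum_congr rfl fun x hx => ?_
    obtain ⟨hxX, hxr⟩ := Finset.mem_filter.mp hx
    rw [hw x hxX x₀ hx₀ (hxr.trans hx₀r.symm)]
  rw [← Finset.sum_coe_sort] at h2
  exact (mul_eq_zero.mp h2).resolve_left (hX.weight_pos x₀ hx₀).ne'

theorem card_radii_mul_le {d : ℕ} {X : Finset (EuclideanSpace ℝ (Fin d))} {m : ℕ}
    (h : ∀ r ∈ radii X, m ≤ (X.filter fun x => ‖x‖ = r).card) : (radii X).card * m ≤ X.card := by
  rw [Finset.card_eq_sum_card_image (fun x => ‖x‖) X, ← smul_eq_mul]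
  exact Finset.card_nsmul_le_sum _ _ _ h

end EuclideanDesign

theorem corollary3p3 (d t p : ℕ) (hd : 2 ≤ d)
    (X : Finset (EuclideanSpace ℝ (Fin d))) (w : EuclideanSpace ℝ (Fin d) → ℝ)
    (hX : EuclideanDesign.IsStrongEuclideanDesign t X w)
    (hp : (EuclideanDesign.radii X).card = p)
    (hw : ∀ x ∈ X, ∀ y ∈ X, ‖x‖ = ‖y‖ → w x = w y)
    (hpt : p ≤ t + 1) :
    (∀ e : ℕ, t = 2 * e →
      p * ((d + e - 1).choose e + (if e = 0 then 0 else (d + e - 2).choose (e - 1))) ≤ X.card) ∧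
    (∀ e : ℕ, t = 2 * e + 1 → 2 * p * (d + e - 1).choose e ≤ X.card) := by
  subst hp
  have hne : ∀ r ∈ EuclideanDesign.radii X, Nonempty {x // x ∈ X.filter fun x => ‖x‖ = r} := by
    intro r hr
    obtain ⟨x, hx, hxr⟩ := Finset.mem_image.mp hr
    exact ⟨⟨x, Finset.mem_filter.mpr ⟨hx, hxr⟩⟩⟩
  refine ⟨fun e he => EuclideanDesign.card_radii_mul_le fun r hr => ?_, fun e he => ?_⟩
  · have := hne r hr
    rw [← Fintype.card_coe]
    rcases e with _ | e
    · rw [if_pos rfl, Nat.choose_zero_right]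
      exact Fintype.card_pos_iff.mpr this
    · have h := (hX.isSphericalDesign_layer hd hw hpt hr).choose_add_choose_le_card hd he.ge
      rwa [if_neg (Nat.succ_ne_zero e), show d + (e + 1) - 2 = d + e - 1 by omega,
        Nat.add_sub_cancel]
  · rw [mul_comm 2, mul_assoc]
    refine EuclideanDesign.card_radii_mul_le fun r hr => ?_
    have := hne r hr
    rw [← Fintype.card_coe]
    exact (hX.isSphericalDesign_layer hd hw hpt hr).two_mul_choose_le_card hd he.ge
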